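/- Let $d\ge1$ be an integer, let $\mathbb S^d\subset\mathbb R^{d+1}$ be the unit sphere with its uniform probability measure $d\mu$, gradient $\nabla$ and Laplace–Beltrami operator $\Delta$. Let $$2^\#:=\frac{2d^2+1}{(d-1)^2}\ \text{ if } d\ge2,\quad 2^\#:=+\infty\ \text{ if } d=1,\qquad 2^*:=\frac{2d}{d-2}\ \text{ if } d\ge3,\quad 2^*:=+\infty\ \text{ if } d\in\{1,2\}.$$ For $p>2$ and a positive function $\rho$ on $\mathbb S^d$, define $$\mathcal E_p[\rho]:=\frac1{p-2}\left[\Big(\int_{\mathbb S^d}\rho\,d\mu\Big)^{2/p}-\int_{\mathbb S^d}\rho^{2/p}\,d\mu\right],\qquad \mathcal I_p[\rho]:=\int_{\mathbb S^d}\big|\nabla\rho^{1/p}\big|^2\,d\mu .$$ A classical solution of the heat equation $\frac{\partial\rho}{\partial t}=\Delta\rho$ with initial datum $\rho_0$ is a function $\rho$ on $[0,\infty)\times\mathbb S^d$ that is continuous, satisfies $\rho(0,\cdot)=\rho_0$, and, for $t>0$, is of class $C^2$ in space, differentiable in time, and satisfies the equation at every point. **Proposition.** For every real $p\in(2^\#,2^*)$,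 and also for $p=2^*$ if $d\ge3$, there exists a smooth positive function $\rho_0$ on $\mathbb S^d$ such that the heat equation has a classical solution with initial datum $\rho_0$ and, if $\rho$ is any classical solution with initial datum $\rho_0$, then $t\mapsto\mathcal I_p[\rho(t,\cdot)]-d\,\mathcal E_p[\rho(t,\cdot)]$ has a one-sided derivative at $t=0$ (from the right), and $$\frac{d}{dt}\Big(\mathcal I_p[\rho(t,\cdot)]-d\,\mathcal E_p[\rho(t,\cdot)]\Big)\Big|_{t=0}>0 .$$ -/

import Mathlib

open MeasureTheory Metric Set
open scoped Manifold ContDiff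

noncomputable section

namespace SphereHeat

/-- The unit sphere `S^d` of `ℝ^(d+1)`. -/
abbrev S (d : ℕ) : Type := sphere (0 : EuclideanSpace ℝ (Fin (d + 1))) 1

/-- The dimension fact through which Mathlib gives `S^d` its smooth structure. -/
instance instFactFinrank (d : ℕ) :
    Fact (Module.finrank ℝ (EuclideanSpace ℝ (Fin (d + 1))) = d + 1) :=
  ⟨finrank_euclideanSpace_fin⟩

/-- The uniform probability measure on `S^d`: the normalized surface measure. -/
def unif (d : ℕ) : Measure (S d) :=
  ((volume : Measure (EuclideanSpace ℝ (Fin (d + 1)))).toSphere univ)⁻¹ •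
    (volume : Measure (EuclideanSpace ℝ (Fin (d + 1)))).toSphere

/-- The extension of `f : S^d → ℝ` to `ℝ^(d+1) ∖ {0}` that is constant along rays,
`y ↦ f (y / ‖y‖)` (the value at the origin plays no role). -/
def radialExt {d : ℕ} (f : S d → ℝ) (y : EuclideanSpace ℝ (Fin (d + 1))) : ℝ :=
  if hy : y = 0 then 0
  else f ⟨‖y‖⁻¹ • y, by
    rw [mem_sphere_zero_iff_norm, norm_smul, norm_inv, norm_norm,
      inv_mul_cancel₀ (norm_ne_zero_iff.mpr hy)]⟩

/-- The gradient of `f` on `S^d`: at a point of the sphere, the Euclidean gradient of the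
extension that is constant along rays is tangent to the sphere, and it is the Riemannian
gradient of `f`. -/
def grad {d : ℕ} (f : S d → ℝ) (x : S d) : EuclideanSpace ℝ (Fin (d + 1)) :=
  gradient (radialExt f) (x : EuclideanSpace ℝ (Fin (d + 1)))

/-- The Laplace–Beltrami operator of `S^d`: at a point of the sphere, the Euclidean Laplacian of
the extension that is constant along rays. -/
def lapBeltrami {d : ℕ} (f : S d → ℝ) (x : S d) : ℝ :=
  Laplacian.laplacian (radialExt f) (x : EuclideanSpace ℝ (Fin (d + 1)))

/-- The entropy `E_p[ρ] = (1 / (p - 2)) ((∫ ρ)^(2/p) - ∫ ρ^(2/p))`, for `p ≠ 2` and `ρ > 0`. -/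
def entropy {d : ℕ} (p : ℝ) (ρ : S d → ℝ) : ℝ :=
  1 / (p - 2) * ((∫ x, ρ x ∂unif d) ^ (2 / p) - ∫ x, ρ x ^ (2 / p) ∂unif d)

/-- The Fisher information `I_p[ρ] = ∫ |∇ ρ^(1/p)|²`, for `ρ > 0`. -/
def fisher {d : ℕ} (p : ℝ) (ρ : S d → ℝ) : ℝ :=
  ∫ x, ‖grad (fun y => ρ y ^ (1 / p)) x‖ ^ 2 ∂unif d

/-- `ρ` is a classical solution on `[0, ∞) × S^d` of the heat equation `∂ρ/∂t = Δρ` with initial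
datum `ρ₀`: it is continuous up to `t = 0`, of class `C²` in space for `t > 0`, differentiable in
time for `t > 0`, and it solves the equation pointwise. -/
structure IsHeatSolution {d : ℕ} (ρ₀ : S d → ℝ) (ρ : ℝ → S d → ℝ) : Prop where
  initial : ρ 0 = ρ₀
  continuousOn : ContinuousOn (fun q : ℝ × S d => ρ q.1 q.2) (Ici 0 ×ˢ univ)
  contMDiff : ∀ t, 0 < t → ContMDiff (𝓡 d) 𝓘(ℝ, ℝ) 2 (ρ t)
  heat : ∀ t, 0 < t → ∀ x, HasDerivAt (fun s => ρ s x) (lapBeltrami (ρ t) x) t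

/-- The exponent `2^# = (2 d² + 1) / (d - 1)²`, equal to `+∞` when `d = 1`. -/
def twoSharp (d : ℕ) : EReal :=
  if d = 1 then ⊤ else (((2 * (d : ℝ) ^ 2 + 1) / ((d : ℝ) - 1) ^ 2 : ℝ) : EReal)

/-- The critical exponent `2^* = 2 d / (d - 2)`, equal to `+∞` when `d = 1` or `d = 2`. -/
def twoStar (d : ℕ) : EReal :=
  if d ≤ 2 then ⊤ else ((2 * (d : ℝ) / ((d : ℝ) - 2) : ℝ) : EReal)

end SphereHeat

end

noncomputable section

namespace SphereHeat

open Filter Topology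

variable {d : ℕ}

/-! Take zonal data, functions of `z = coord 0 x`. With `u = ρ^(1/p)`, the heat flow becomes `u_t =
Lu + (p-1)(1-z²)u'²/u`, where `Lu = (1-z²)u'' - d z u'`. Integration by parts turns the derivative
of `I_p - d E_p` into `-2 ∫ (1-z²)² Q`, where `Q` is a quadratic form in `u''` and `u'²/u`
(`integral_dissipation`). Completing the square gives `Q = (u'' - c u'²/u)² - δ (u'²/u)²`, and `δ >
0` is exactly `p > 2^#`. It remains to find a positive profile for which the square is negligible,
so that `Q < 0` on all of `[-1,1]`.

Such a profile exists among the quadratic polynomials `ρ₀ = 1 + εz + qε²z²` with `ε` small: `q`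
cancels the square to leading order (`exists_profile_dissipation_neg`). A quadratic in `z` is a sum
of spherical harmonics of degree at most 2, so its heat flow is explicit, and everything can be
differentiated under the integral. The maximum principle identifies any classical solution with this
flow (`IsHeatSolution.unique`).

Integration by parts comes from rotation invariance of the measure, without computing the law of `z`
(`integral_zonal_eq_zero`). -/

/-- Differentiation under the integral sign on a compact space. -/
lemma hasDerivAt_integral_of_continuousOn {K : Type*} [TopologicalSpace K] [CompactSpace K]
    [MeasurableSpace K] [BorelSpace K] (μ : Measure K) [IsFiniteMeasure μ]
    {F F' : ℝ → K → ℝ} {a τ : ℝ} (hτ : 0 < τ)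
    (hF : ∀ t ∈ Icc (a - τ) (a + τ), Continuous (F t))
    (hF' : ContinuousOn (fun q : ℝ × K => F' q.1 q.2) (Icc (a - τ) (a + τ) ×ˢ univ))
    (h : ∀ t ∈ Icc (a - τ) (a + τ), ∀ x, HasDerivAt (fun s => F s x) (F' t x) t) :
    HasDerivAt (fun t => ∫ x, F t x ∂μ) (∫ x, F' a x ∂μ) a := by
  obtain ⟨C, hC⟩ := (isCompact_Icc.prod isCompact_univ).exists_bound_of_continuousOn hF'
  have hnhds : Icc (a - τ) (a + τ) ∈ 𝓝 a := Icc_mem_nhds (by linarith) (by linarith)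
  have ha := mem_of_mem_nhds hnhds
  have hint : ∀ g : K → ℝ, Continuous g → Integrable g μ := fun g hg =>
    hg.integrable_of_hasCompactSupport (HasCompactSupport.of_compactSpace g)
  have hFa : Continuous (F' a) := by
    rw [← continuousOn_univ]
    exact hF'.comp (by fun_prop) (fun x _ => ⟨ha, mem_univ x⟩) (f := fun x => (a, x))
  refine (hasDerivAt_integral_of_dominated_loc_of_deriv_le (bound := fun _ => C) hnhds
    ?_ (hint _ (hF a ha)) (hint _ hFa).aestronglyMeasurable ?_ (integrable_const _) ?_).2
  · filter_upwards [hnhds] with t ht using (hint _ (hF t ht)).aestronglyMeasurable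
  · exact ae_of_all _ fun x t ht => hC (t, x) ⟨ht, mem_univ x⟩
  · exact ae_of_all _ fun x t ht => h t ht x

/-! ### Second derivatives along lines; the Laplacian at a maximum -/

section Line

variable {E : Type*} [NormedAddCommGroup E] [NormedSpace ℝ E] {f : E → ℝ} {x : E}

lemma eventually_hasDerivAt_line (hf : ContDiffAt ℝ 2 f x) (e : E) :
    ∀ᶠ s in 𝓝 (0 : ℝ), HasDerivAt (fun s : ℝ => f (x + s • e)) (fderiv ℝ f (x + s • e) e) s := by
  have hev : ∀ᶠ y in 𝓝 x, ContDiffAt ℝ 2 f y := hf.eventually (by simp)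
  have ht : Tendsto (fun s : ℝ => x + s • e) (𝓝 0) (𝓝 x) := by
    have : Continuous fun s : ℝ => x + s • e := by fun_prop
    simpa using this.tendsto 0
  filter_upwards [ht.eventually hev] with s hs
  have hl : HasDerivAt (fun s : ℝ => x + s • e) e s := by
    simpa using ((hasDerivAt_id s).smul_const e).const_add x
  exact (hs.differentiableAt (by norm_num)).hasFDerivAt.comp_hasDerivAt s hl

lemma hasDerivAt_fderiv_line (hf : ContDiffAt ℝ 2 f x) (e : E) :
    HasDerivAt (fun s : ℝ => fderiv ℝ f (x + s • e) e) (iteratedFDeriv ℝ 2 f x ![e, e]) 0 := by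
  have hl : HasDerivAt (fun s : ℝ => x + s • e) e 0 := by
    simpa using ((hasDerivAt_id (0 : ℝ)).smul_const e).const_add x
  have h1 : HasFDerivAt (fderiv ℝ f) (fderiv ℝ (fderiv ℝ f) x) (x + (0 : ℝ) • e) := by
    simpa using ((hf.fderiv_right (m := 1) (by norm_num)).differentiableAt
      (by norm_num)).hasFDerivAt
  have h2 := ((ContinuousLinearMap.apply ℝ ℝ e).hasFDerivAt.comp_hasDerivAt (0 : ℝ)
    (h1.comp_hasDerivAt (0 : ℝ) hl))
  rw [iteratedFDeriv_two_apply]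
  exact h2

/-- The second derivative along a line, computed from an explicit first derivative. -/
lemma iteratedFDeriv_two_eq_of_hasDerivAt (hf : ContDiffAt ℝ 2 f x) (e : E) {φ' : ℝ → ℝ} {c : ℝ}
    (h1 : ∀ᶠ s in 𝓝 (0 : ℝ), HasDerivAt (fun s : ℝ => f (x + s • e)) (φ' s) s)
    (h2 : HasDerivAt φ' c 0) : iteratedFDeriv ℝ 2 f x ![e, e] = c := by
  have : (fun s : ℝ => fderiv ℝ f (x + s • e) e) =ᶠ[𝓝 0] φ' := by
    filter_upwards [h1, eventually_hasDerivAt_line hf e] with s ha hb using hb.unique ha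
  exact (hasDerivAt_fderiv_line hf e).unique (h2.congr_of_eventuallyEq this)

lemma iteratedFDeriv_two_nonpos_of_isLocalMax (hf : ContDiffAt ℝ 2 f x) (hmax : IsLocalMax f x)
    (e : E) : iteratedFDeriv ℝ 2 f x ![e, e] ≤ 0 := by
  set φ : ℝ → ℝ := fun s => f (x + s • e) with hφ
  have hev := eventually_hasDerivAt_line hf e
  have hd : deriv φ =ᶠ[𝓝 0] fun s => fderiv ℝ f (x + s • e) e := by
    filter_upwards [hev] with s hs using hs.deriv
  have h2 : HasDerivAt (deriv φ) (iteratedFDeriv ℝ 2 f x ![e, e]) 0 :=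
    (hasDerivAt_fderiv_line hf e).congr_of_eventuallyEq hd
  have ht : Tendsto (fun s : ℝ => x + s • e) (𝓝 0) (𝓝 x) := by
    have : Continuous fun s : ℝ => x + s • e := by fun_prop
    simpa using this.tendsto 0
  have hm : IsLocalMax φ 0 := by
    have := ht.eventually hmax
    simpa [IsLocalMax, IsMaxFilter, hφ] using this
  by_contra! hpos
  have hc : ContinuousAt φ 0 := hev.self_of_nhds.continuousAt
  -- A positive second derivative would make the maximum also a minimum, so `φ` would be locally
  -- constant and its second derivative zero.
  have hmin := isLocalMin_of_deriv_deriv_pos (by rw [h2.deriv]; exact hpos) hm.deriv_eq_zero hc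
  have hconst : φ =ᶠ[𝓝 0] fun _ => φ 0 := by
    filter_upwards [hm, hmin] with s h1 h2 using le_antisymm h1 h2
  have h0 : deriv (deriv φ) 0 = 0 := by
    rw [hconst.deriv.deriv_eq]; simp
  rw [h2.deriv] at h0
  exact hpos.ne' h0

lemma laplacian_nonpos_of_isLocalMax {E : Type*} [NormedAddCommGroup E] [InnerProductSpace ℝ E]
    [FiniteDimensional ℝ E] {f : E → ℝ} {x : E} (hf : ContDiffAt ℝ 2 f x)
    (hmax : IsLocalMax f x) : Laplacian.laplacian f x ≤ 0 := by
  rw [InnerProductSpace.laplacian_eq_iteratedFDeriv_stdOrthonormalBasis]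
  exact Finset.sum_nonpos fun i _ => iteratedFDeriv_two_nonpos_of_isLocalMax hf hmax _

end Line

/-! ### Radial extensions, maximum principle and uniqueness -/

/-- The radial projection onto the sphere, extended by a base point at the origin. -/
def radialProj (x₀ : S d) (y : EuclideanSpace ℝ (Fin (d + 1))) : S d :=
  if hy : y = 0 then x₀
  else ⟨‖y‖⁻¹ • y, by
    rw [mem_sphere_zero_iff_norm, norm_smul, norm_inv, norm_norm,
      inv_mul_cancel₀ (norm_ne_zero_iff.mpr hy)]⟩

lemma coe_radialProj (x₀ : S d) {y : EuclideanSpace ℝ (Fin (d + 1))} (hy : y ≠ 0) :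
    (radialProj x₀ y : EuclideanSpace ℝ (Fin (d + 1))) = ‖y‖⁻¹ • y := by
  simp [radialProj, hy]

lemma radialExt_eq (f : S d → ℝ) (x₀ : S d) {y : EuclideanSpace ℝ (Fin (d + 1))} (hy : y ≠ 0) :
    radialExt f y = f (radialProj x₀ y) := by
  simp [radialExt, radialProj, hy]

lemma norm_coe (x : S d) : ‖(x : EuclideanSpace ℝ (Fin (d + 1)))‖ = 1 :=
  mem_sphere_zero_iff_norm.mp x.2

lemma coe_ne_zero (x : S d) : (x : EuclideanSpace ℝ (Fin (d + 1))) ≠ 0 :=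
  norm_ne_zero_iff.mp (by rw [norm_coe]; exact one_ne_zero)

lemma radialProj_coe (x₀ x : S d) :
    radialProj x₀ (x : EuclideanSpace ℝ (Fin (d + 1))) = x := by
  apply Subtype.ext
  rw [coe_radialProj x₀ (coe_ne_zero x), norm_coe, inv_one, one_smul]

lemma radialExt_coe (f : S d → ℝ) (x : S d) :
    radialExt f (x : EuclideanSpace ℝ (Fin (d + 1))) = f x := by
  rw [radialExt_eq f x (coe_ne_zero x), radialProj_coe]

/-- Off the origin the extension is `f` composed with `y ↦ y/‖y‖`, which is smooth as a map into the
sphere. This passes manifold regularity to the Euclidean calculus defining `grad` and `lapBeltrami`.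
-/
lemma contDiffAt_radialExt {f : S d → ℝ} {n : ℕ∞ω} (hf : ContMDiff (𝓡 d) 𝓘(ℝ, ℝ) n f) (x : S d) :
    ContDiffAt ℝ n (radialExt f) (x : EuclideanSpace ℝ (Fin (d + 1))) := by
  let U : TopologicalSpace.Opens (EuclideanSpace ℝ (Fin (d + 1))) := ⟨{0}ᶜ, isOpen_compl_singleton⟩
  let g : U → EuclideanSpace ℝ (Fin (d + 1)) := fun y => ‖y.1‖⁻¹ • y.1
  have hne : ∀ y : U, (y : EuclideanSpace ℝ (Fin (d + 1))) ≠ 0 := fun y => y.2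
  have hg : ContMDiff 𝓘(ℝ, EuclideanSpace ℝ (Fin (d + 1)))
      𝓘(ℝ, EuclideanSpace ℝ (Fin (d + 1))) n g := by
    intro y
    have h : ContDiffAt ℝ n (fun y : EuclideanSpace ℝ (Fin (d + 1)) => ‖y‖⁻¹ • y)
        (y : EuclideanSpace ℝ (Fin (d + 1))) :=
      ((contDiffAt_norm ℝ (hne y)).inv (norm_ne_zero_iff.2 (hne y))).smul contDiffAt_id
    exact h.contMDiffAt.comp y contMDiff_subtype_val.contMDiffAt
  have hmem : ∀ y : U, g y ∈ sphere (0 : EuclideanSpace ℝ (Fin (d + 1))) 1 := fun y => by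
    rw [mem_sphere_zero_iff_norm, norm_smul, norm_inv, norm_norm,
      inv_mul_cancel₀ (norm_ne_zero_iff.mpr (hne y))]
  have hcomp := hf.comp (hg.codRestrict_sphere hmem)
  have heq : (f ∘ Set.codRestrict g _ hmem) = fun y : U => radialExt f y := by
    ext y
    simp only [Function.comp_apply, radialExt, dif_neg (hne y)]
    rfl
  rw [heq] at hcomp
  exact (contMDiffAt_subtype_iff.1 (hcomp ⟨x, coe_ne_zero x⟩)).contDiffAt

lemma radialExt_sub (f g : S d → ℝ) : radialExt (f - g) = radialExt f - radialExt g := by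
  ext y
  by_cases hy : y = 0 <;> simp [radialExt, hy]

lemma lapBeltrami_sub {f g : S d → ℝ} (hf : ContMDiff (𝓡 d) 𝓘(ℝ, ℝ) 2 f)
    (hg : ContMDiff (𝓡 d) 𝓘(ℝ, ℝ) 2 g) (x : S d) :
    lapBeltrami (f - g) x = lapBeltrami f x - lapBeltrami g x := by
  rw [lapBeltrami, radialExt_sub]
  exact (contDiffAt_radialExt hf x).laplacian_sub (contDiffAt_radialExt hg x)

/-- Constancy along rays makes a maximum on the sphere a local maximum of the extension in the
ambient space. -/
lemma lapBeltrami_nonpos_of_max {f : S d → ℝ} (hf : ContMDiff (𝓡 d) 𝓘(ℝ, ℝ) 2 f) {x : S d}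
    (hx : ∀ y, f y ≤ f x) : lapBeltrami f x ≤ 0 := by
  apply laplacian_nonpos_of_isLocalMax (contDiffAt_radialExt hf x)
  filter_upwards [isOpen_ne.mem_nhds (coe_ne_zero x)] with y hy
  rw [radialExt_eq f x hy, radialExt_coe]
  exact hx _

/-- The weak maximum principle for the difference of two solutions with the same datum. -/
lemma IsHeatSolution.le {ρ₀ : S d → ℝ} {ρ σ : ℝ → S d → ℝ} (hρ : IsHeatSolution ρ₀ ρ)
    (hσ : IsHeatSolution ρ₀ σ) {t : ℝ} (ht : 0 ≤ t) (x : S d) : ρ t x ≤ σ t x := by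
  apply le_of_forall_pos_le_add
  intro η hη
  -- The penalty `ε * s` makes the time derivative strictly negative at a maximum with `s > 0`,
  -- while costing at most `η` at time `t`.
  set ε := η / (t + 1) with hε
  have hε0 : 0 < ε := by positivity
  set w : ℝ × S d → ℝ := fun q => ρ q.1 q.2 - σ q.1 q.2 - ε * q.1 with hw
  have hcont : ContinuousOn w (Icc 0 t ×ˢ univ) := by
    have hsub : (Icc 0 t ×ˢ univ : Set (ℝ × S d)) ⊆ Ici 0 ×ˢ univ :=
      prod_mono Icc_subset_Ici_self subset_rfl
    exact ((hρ.continuousOn.mono hsub).sub (hσ.continuousOn.mono hsub)).sub (by fun_prop)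
  obtain ⟨⟨s, y⟩, ⟨hs, -⟩, hmax⟩ := (isCompact_Icc.prod isCompact_univ).exists_isMaxOn
    ⟨(t, x), ⟨ht, le_rfl⟩, mem_univ _⟩ hcont
  have hmax' : ∀ s' ∈ Icc 0 t, ∀ y', w (s', y') ≤ w (s, y) := fun s' h' y' =>
    hmax (Set.mk_mem_prod h' (mem_univ y'))
  have hs0 : s = 0 := by
    by_contra hne
    have hpos : 0 < s := lt_of_le_of_ne hs.1 (Ne.symm hne)
    have hlap : lapBeltrami (ρ s) y - lapBeltrami (σ s) y ≤ 0 := by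
      rw [← lapBeltrami_sub (hρ.contMDiff s hpos) (hσ.contMDiff s hpos)]
      apply lapBeltrami_nonpos_of_max ((hρ.contMDiff s hpos).sub (hσ.contMDiff s hpos))
      intro y'
      have := hmax' s hs y'
      simp only [hw] at this
      change ρ s y' - σ s y' ≤ ρ s y - σ s y
      linarith
    have hder : HasDerivAt (fun s => w (s, y))
        (lapBeltrami (ρ s) y - lapBeltrami (σ s) y - ε * 1) s :=
      ((hρ.heat s hpos y).sub (hσ.heat s hpos y)).sub ((hasDerivAt_id s).const_mul ε)
    have hge : 0 ≤ lapBeltrami (ρ s) y - lapBeltrami (σ s) y - ε * 1 := by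
      -- Only left slopes are used, since the maximum may sit at the final time `s = t`.
      have htend := hasDerivWithinAt_iff_tendsto_slope.1 (hder.hasDerivWithinAt (s := Iio s))
      have hne : (𝓝[Iio s \ {s}] s).NeBot := by
        rw [sdiff_singleton_eq_self (by simp)]; infer_instance
      refine ge_of_tendsto htend ?_
      rw [sdiff_singleton_eq_self (by simp)]
      filter_upwards [Ioo_mem_nhdsLT hpos] with r hr
      rw [slope_def_field]
      exact div_nonneg_of_nonpos (sub_nonpos.2 (hmax' r ⟨hr.1.le, hr.2.le.trans hs.2⟩ y))
        (sub_nonpos.2 hr.2.le)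
    linarith
  have hfin := hmax' t ⟨ht, le_rfl⟩ x
  simp only [hw, hs0, hρ.initial, hσ.initial] at hfin
  have : ε * t ≤ η := by
    rw [hε, div_mul_eq_mul_div, div_le_iff₀ (by positivity)]
    nlinarith
  linarith

lemma IsHeatSolution.unique {ρ₀ : S d → ℝ} {ρ σ : ℝ → S d → ℝ} (hρ : IsHeatSolution ρ₀ ρ)
    (hσ : IsHeatSolution ρ₀ σ) {t : ℝ} (ht : 0 ≤ t) : ρ t = σ t :=
  funext fun x => le_antisymm (hρ.le hσ ht x) (hσ.le hρ ht x)

/-! ### The uniform measure and its invariance under isometries -/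

instance instIsFiniteMeasureUnif : IsFiniteMeasure (unif d) := by
  refine ⟨?_⟩
  rw [unif, Measure.smul_apply, smul_eq_mul]
  refine ENNReal.mul_lt_top (ENNReal.inv_lt_top.2 ?_) (measure_lt_top _ _)
  rw [pos_iff_ne_zero, Ne, Measure.measure_univ_eq_zero]
  exact Measure.toSphere_ne_zero _

instance instIsOpenPosMeasureUnif : (unif d).IsOpenPosMeasure := by
  refine ⟨fun U hU hne => ?_⟩
  rw [unif, Measure.smul_apply, smul_eq_mul]
  exact mul_ne_zero (ENNReal.inv_ne_zero.2 (measure_ne_top _ _)) (hU.measure_ne_zero _ hne)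

lemma integrable_unif {f : S d → ℝ} (hf : Continuous f) : Integrable f (unif d) :=
  hf.integrable_of_hasCompactSupport (HasCompactSupport.of_compactSpace f)

/-- The action of a linear isometry on the sphere. -/
def isometryMap (A : EuclideanSpace ℝ (Fin (d + 1)) ≃ₗᵢ[ℝ] EuclideanSpace ℝ (Fin (d + 1)))
    (x : S d) : S d :=
  ⟨A x, by rw [mem_sphere_zero_iff_norm, A.norm_map, norm_coe]⟩

lemma continuous_isometryMap
    (A : EuclideanSpace ℝ (Fin (d + 1)) ≃ₗᵢ[ℝ] EuclideanSpace ℝ (Fin (d + 1))) :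
    Continuous (isometryMap A) :=
  (A.continuous.comp continuous_subtype_val).subtype_mk _

-- The surface measure of `s` is a multiple of the volume of the cone `Ioo 0 1 • s`, and linear
-- isometries preserve volume and commute with taking cones.
open scoped Pointwise in
lemma measurePreserving_isometryMap
    (A : EuclideanSpace ℝ (Fin (d + 1)) ≃ₗᵢ[ℝ] EuclideanSpace ℝ (Fin (d + 1))) :
    MeasurePreserving (isometryMap A) (unif d) (unif d) := by
  have hm := (continuous_isometryMap A).measurable
  have h : MeasurePreserving (isometryMap A)
      (volume : Measure (EuclideanSpace ℝ (Fin (d + 1)))).toSphere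
      (volume : Measure (EuclideanSpace ℝ (Fin (d + 1)))).toSphere := by
    refine ⟨hm, Measure.ext fun s hs => ?_⟩
    rw [Measure.map_apply hm hs, Measure.toSphere_apply' _ hs, Measure.toSphere_apply' _ (hm hs)]
    congr 1
    have : Ioo (0 : ℝ) 1 • (((↑) : S d → EuclideanSpace ℝ (Fin (d + 1))) '' (isometryMap A ⁻¹' s))
        = A ⁻¹' (Ioo (0 : ℝ) 1 • (((↑) : S d → EuclideanSpace ℝ (Fin (d + 1))) '' s)) := by
      ext y
      simp only [Set.mem_smul, mem_image, mem_preimage]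
      constructor
      · rintro ⟨r, hr, _, ⟨x, hx, rfl⟩, rfl⟩
        exact ⟨r, hr, A x, ⟨_, hx, rfl⟩, by simp⟩
      · rintro ⟨r, hr, _, ⟨x, hx, rfl⟩, hy⟩
        refine ⟨r, hr, A.symm x, ⟨isometryMap A.symm x, ?_, rfl⟩, ?_⟩
        · have : isometryMap A (isometryMap A.symm x) = x := by
            apply Subtype.ext; simp [isometryMap]
          rwa [this]
        · apply A.injective
          rw [← hy]; simp
    rw [this]
    exact A.measurePreserving.measure_preimage_equiv (f := A.toMeasurableEquiv) _
  exact ⟨hm, by rw [unif, Measure.map_smul, h.map_eq]⟩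

lemma integral_isometryMap
    (A : EuclideanSpace ℝ (Fin (d + 1)) ≃ₗᵢ[ℝ] EuclideanSpace ℝ (Fin (d + 1)))
    {f : S d → ℝ} (hf : Continuous f) :
    ∫ x, f (isometryMap A x) ∂unif d = ∫ x, f x ∂unif d := by
  have h := measurePreserving_isometryMap A
  conv_rhs => rw [← h.map_eq]
  rw [integral_map h.measurable.aemeasurable hf.aestronglyMeasurable]

/-! ### Rotations and integration by parts for zonal functions -/

section Rotation

variable {E : Type*} [NormedAddCommGroup E] [InnerProductSpace ℝ E]

/-- The rotation by the angle `-θ` in the plane of the orthonormal vectors `u` and `v`. -/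
def rotation (u v : E) (hu : ‖u‖ = 1) (hv : ‖v‖ = 1) (huv : inner ℝ u v = 0) (θ : ℝ) :
    E →ₗᵢ[ℝ] E where
  toFun y := y + ((Real.cos θ - 1) * inner ℝ u y + Real.sin θ * inner ℝ v y) • u +
    ((Real.cos θ - 1) * inner ℝ v y - Real.sin θ * inner ℝ u y) • v
  map_add' x y := by
    simp only [inner_add_right]
    module
  map_smul' c x := by
    simp only [inner_smul_right, RingHom.id_apply]
    module
  norm_map' y := by
    change ‖y + ((Real.cos θ - 1) * inner ℝ u y + Real.sin θ * inner ℝ v y) • u +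
      ((Real.cos θ - 1) * inner ℝ v y - Real.sin θ * inner ℝ u y) • v‖ = ‖y‖
    rw [← sq_eq_sq₀ (norm_nonneg _) (norm_nonneg _)]
    rw [norm_add_sq_real, norm_add_sq_real]
    simp only [inner_add_left, inner_smul_left, inner_smul_right, norm_smul, hu, hv, huv,
      real_inner_comm u y, real_inner_comm v y, mul_one, Real.norm_eq_abs, sq_abs, mul_zero,
      add_zero, RCLike.conj_to_real]
    linear_combination ((inner ℝ u y) ^ 2 + (inner ℝ v y) ^ 2) * Real.sin_sq_add_cos_sq θ

end Rotation

/-- The coordinate of a point of the sphere. -/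
abbrev coord (i : Fin (d + 1)) (x : S d) : ℝ := (x : EuclideanSpace ℝ (Fin (d + 1))) i

lemma continuous_coord (i : Fin (d + 1)) : Continuous (coord i : S d → ℝ) := by
  unfold coord; fun_prop

lemma sum_coord_sq (x : S d) : ∑ i, coord i x ^ 2 = 1 := by
  have h := EuclideanSpace.norm_sq_eq (x : EuclideanSpace ℝ (Fin (d + 1)))
  rw [norm_coe] at h
  simpa using h.symm

lemma coord_mem (i : Fin (d + 1)) (x : S d) : coord i x ∈ Icc (-1 : ℝ) 1 := by
  have h := Finset.single_le_sum (f := fun i => coord i x ^ 2) (fun i _ => sq_nonneg _)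
    (Finset.mem_univ i)
  rw [sum_coord_sq] at h
  exact abs_le.1 ((sq_le_one_iff_abs_le_one _).1 h)

lemma continuous_comp_coord {g : ℝ → ℝ} (hg : ContinuousOn g (Icc (-1) 1)) (i : Fin (d + 1)) :
    Continuous fun x : S d => g (coord i x) :=
  hg.comp_continuous (continuous_coord i) (coord_mem i)

lemma exists_rotation (i : Fin (d + 1)) (hi : i ≠ 0) (θ : ℝ) :
    ∃ A : EuclideanSpace ℝ (Fin (d + 1)) ≃ₗᵢ[ℝ] EuclideanSpace ℝ (Fin (d + 1)), ∀ x : S d,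
      coord 0 (isometryMap A x) = Real.cos θ * coord 0 x + Real.sin θ * coord i x ∧
      coord i (isometryMap A x) = Real.cos θ * coord i x - Real.sin θ * coord 0 x := by
  let R := rotation (EuclideanSpace.single (0 : Fin (d + 1)) (1 : ℝ)) (EuclideanSpace.single i 1)
    (by simp) (by simp) (by rw [EuclideanSpace.inner_single_left]; simp [hi.symm]) θ
  refine ⟨R.toLinearIsometryEquiv rfl, fun x => ?_⟩
  constructor
  · change (R x) 0 = _
    simp [R, rotation, hi.symm, coord, EuclideanSpace.inner_single_left]
    ring
  · change (R x) i = _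
    simp [R, rotation, hi, coord, EuclideanSpace.inner_single_left]
    ring

/-- Invariance under the rotations of one coordinate plane, in infinitesimal form. -/
lemma integral_rotation_generator {h h' : ℝ → ℝ} (hh : ∀ z ∈ Icc (-1 : ℝ) 1, HasDerivAt h (h' z) z)
    (hh' : ContinuousOn h' (Icc (-1) 1)) {i : Fin (d + 1)} (hi : i ≠ 0) :
    ∫ x : S d, (coord i x ^ 2 * h' (coord 0 x) - coord 0 x * h (coord 0 x)) ∂unif d = 0 := by
  have hhc : ContinuousOn h (Icc (-1) 1) := fun z hz => (hh z hz).continuousAt.continuousWithinAt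
  set a : ℝ → S d → ℝ := fun θ x => Real.cos θ * coord 0 x + Real.sin θ * coord i x
  set b : ℝ → S d → ℝ := fun θ x => Real.cos θ * coord i x - Real.sin θ * coord 0 x
  -- `a θ x` is a coordinate of a rotated point, so it never leaves the interval where `h` is
  -- controlled.
  have ha : ∀ θ x, a θ x ∈ Icc (-1 : ℝ) 1 := fun θ x => by
    obtain ⟨A, hA⟩ := exists_rotation i hi θ
    simpa only [a, (hA x).1] using coord_mem 0 (isometryMap A x)
  have h0 := continuous_coord (d := d) 0
  have h1 := continuous_coord (d := d) i
  have hac : Continuous fun q : ℝ × S d => a q.1 q.2 := by fun_prop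
  have hbc : Continuous fun q : ℝ × S d => b q.1 q.2 := by fun_prop
  -- The integral does not depend on `θ`; its derivative at `θ = 0` is the claimed identity.
  have hconst : ∀ θ, ∫ x, b θ x * h (a θ x) ∂unif d = ∫ x, coord i x * h (coord 0 x) ∂unif d := by
    intro θ
    obtain ⟨A, hA⟩ := exists_rotation i hi θ
    have hf : Continuous fun x : S d => coord i x * h (coord 0 x) :=
      h1.mul (continuous_comp_coord hhc 0)
    rw [← integral_isometryMap A hf]
    exact integral_congr_ae (ae_of_all _ fun x => by
      simp only [a, b]
      rw [(hA x).1, (hA x).2])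
  have hha : Continuous fun q : ℝ × S d => h (a q.1 q.2) :=
    hhc.comp_continuous hac fun q => ha q.1 q.2
  have hha' : Continuous fun q : ℝ × S d => h' (a q.1 q.2) :=
    hh'.comp_continuous hac fun q => ha q.1 q.2
  have hFc : ∀ θ, Continuous fun x : S d => b θ x * h (a θ x) := fun θ =>
    (hbc.mul hha).comp (continuous_const.prodMk continuous_id : Continuous fun x : S d => (θ, x))
  have hFc' : Continuous fun q : ℝ × S d =>
      -a q.1 q.2 * h (a q.1 q.2) + b q.1 q.2 * (h' (a q.1 q.2) * b q.1 q.2) :=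
    (hac.neg.mul hha).add (hbc.mul (hha'.mul hbc))
  have hder := hasDerivAt_integral_of_continuousOn (unif d) (a := 0) (τ := 1) one_pos
    (F := fun θ x => b θ x * h (a θ x))
    (F' := fun θ x => -a θ x * h (a θ x) + b θ x * (h' (a θ x) * b θ x))
    (fun θ _ => hFc θ) hFc'.continuousOn
    (fun θ _ x => by
      have da : HasDerivAt (fun θ => a θ x) (b θ x) θ := by
        refine (((Real.hasDerivAt_cos θ).mul_const _).add
          ((Real.hasDerivAt_sin θ).mul_const _)).congr_deriv ?_
        simp only [b]; ring
      have db : HasDerivAt (fun θ => b θ x) (-a θ x) θ := by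
        refine (((Real.hasDerivAt_cos θ).mul_const _).sub
          ((Real.hasDerivAt_sin θ).mul_const _)).congr_deriv ?_
        simp only [a]; ring
      exact db.mul ((hh _ (ha θ x)).comp θ da))
  simp only [hconst] at hder
  have := hder.unique (hasDerivAt_const _ _)
  rw [← this]
  refine integral_congr_ae (ae_of_all _ fun x => ?_)
  simp only [a, b, Real.cos_zero, Real.sin_zero]
  ring_nf

/-- Integration by parts for zonal functions. -/
lemma integral_zonal_eq_zero {h h' : ℝ → ℝ} (hh : ∀ z ∈ Icc (-1 : ℝ) 1, HasDerivAt h (h' z) z)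
    (hh' : ContinuousOn h' (Icc (-1) 1)) :
    ∫ x : S d, ((1 - coord 0 x ^ 2) * h' (coord 0 x) - d * coord 0 x * h (coord 0 x)) ∂unif d
      = 0 := by
  have hhc : ContinuousOn h (Icc (-1) 1) := fun z hz => (hh z hz).continuousAt.continuousWithinAt
  -- Add up the `d` coordinate planes containing the axis, using that the other squared coordinates
  -- sum to `1 - z²`.
  have key : ∀ x : S d, (1 - coord 0 x ^ 2) * h' (coord 0 x) - d * coord 0 x * h (coord 0 x)
      = ∑ j : Fin d,
        (coord j.succ x ^ 2 * h' (coord 0 x) - coord 0 x * h (coord 0 x)) := by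
    intro x
    have := sum_coord_sq x
    rw [Fin.sum_univ_succ] at this
    rw [Finset.sum_sub_distrib, ← Finset.sum_mul, ← this]
    simp
    ring
  simp_rw [key]
  rw [integral_finsetSum]
  · exact Finset.sum_eq_zero fun j _ => integral_rotation_generator hh hh' (Fin.succ_ne_zero j)
  · intro j _
    exact integrable_unif ((((continuous_coord _).pow 2).mul (continuous_comp_coord hh' 0)).sub
      ((continuous_coord 0).mul (continuous_comp_coord hhc 0)))

/-! ### Gradient and Laplacian of zonal functions -/

/-- A power of `‖y‖²` can be differentiated by the `rpow` rules, and `‖y‖²` is a polynomial along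
lines. -/
lemma inv_norm_eq_rpow {E : Type*} [NormedAddCommGroup E] (y : E) :
    ‖y‖⁻¹ = (‖y‖ ^ 2) ^ (-(1 / 2) : ℝ) := by
  rw [← Real.rpow_natCast, ← Real.rpow_mul (norm_nonneg y)]
  norm_num
  rw [Real.rpow_neg_one]

lemma contMDiff_coord {n : ℕ∞ω} (i : Fin (d + 1)) :
    ContMDiff (𝓡 d) 𝓘(ℝ, ℝ) n (coord i : S d → ℝ) := by
  have h : ContDiff ℝ n fun y : EuclideanSpace ℝ (Fin (d + 1)) => y i := by fun_prop
  exact h.contMDiff.comp contMDiff_coe_sphere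

lemma contMDiff_zonal {n : ℕ∞ω} {g : ℝ → ℝ} (hg : ContDiff ℝ n g) :
    ContMDiff (𝓡 d) 𝓘(ℝ, ℝ) n (fun x : S d => g (coord 0 x)) :=
  hg.contMDiff.comp (contMDiff_coord 0)

lemma radialExt_zonal_eq (g : ℝ → ℝ) {y : EuclideanSpace ℝ (Fin (d + 1))} (hy : y ≠ 0) :
    radialExt (fun x : S d => g (coord 0 x)) y = g ((‖y‖ ^ 2) ^ (-(1 / 2) : ℝ) * y 0) := by
  rw [← inv_norm_eq_rpow]
  simp [radialExt, hy, coord]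

lemma radialExt_zonal_eventuallyEq (g : ℝ → ℝ) (x : S d) :
    radialExt (fun x : S d => g (coord 0 x)) =ᶠ[𝓝 (x : EuclideanSpace ℝ (Fin (d + 1)))]
      fun y => g ((‖y‖ ^ 2) ^ (-(1 / 2) : ℝ) * y 0) := by
  filter_upwards [isOpen_ne.mem_nhds (coe_ne_zero x)] with y hy
  exact radialExt_zonal_eq g hy

lemma grad_zonal {g : ℝ → ℝ} {g' : ℝ} (x : S d) (hg : HasDerivAt g g' (coord 0 x)) :
    grad (fun y => g (coord 0 y)) x =
      g' • (EuclideanSpace.single 0 1 - coord 0 x • (x : EuclideanSpace ℝ (Fin (d + 1)))) := by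
  apply HasGradientAt.gradient
  rw [hasGradientAt_iff_hasFDerivAt]
  refine HasFDerivAt.congr_of_eventuallyEq ?_ (radialExt_zonal_eventuallyEq g x)
  have hn : HasFDerivAt (fun y : EuclideanSpace ℝ (Fin (d + 1)) => (‖y‖ ^ 2) ^ (-(1 / 2) : ℝ)) _
      (x : EuclideanSpace ℝ (Fin (d + 1))) :=
    ((hasStrictFDerivAt_norm_sq (x : EuclideanSpace ℝ (Fin (d + 1)))).hasFDerivAt).rpow_const
      (p := -(1 / 2)) (Or.inl (by simp))
  have hc : HasFDerivAt (fun y : EuclideanSpace ℝ (Fin (d + 1)) => y 0)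
      (EuclideanSpace.proj (0 : Fin (d + 1)) : EuclideanSpace ℝ (Fin (d + 1)) →L[ℝ] ℝ)
      (x : EuclideanSpace ℝ (Fin (d + 1))) :=
    (EuclideanSpace.proj (0 : Fin (d + 1)) :
      EuclideanSpace ℝ (Fin (d + 1)) →L[ℝ] ℝ).hasFDerivAt
  have hz : (‖(x : EuclideanSpace ℝ (Fin (d + 1)))‖ ^ 2) ^ (-(1 / 2) : ℝ) *
      (x : EuclideanSpace ℝ (Fin (d + 1))) 0 = coord 0 x := by simp
  have h := HasDerivAt.comp_hasFDerivAt (x : EuclideanSpace ℝ (Fin (d + 1))) (h₂ := g) (h₂' := g')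
    (show HasDerivAt g g' (_ * _) by rw [hz]; exact hg) (hn.mul hc)
  refine h.congr_fderiv ?_
  ext v
  simp [EuclideanSpace.inner_single_left]
  ring

lemma norm_grad_zonal_sq {g : ℝ → ℝ} {g' : ℝ} (x : S d) (hg : HasDerivAt g g' (coord 0 x)) :
    ‖grad (fun y => g (coord 0 y)) x‖ ^ 2 = (1 - coord 0 x ^ 2) * g' ^ 2 := by
  rw [grad_zonal x hg, norm_smul, mul_pow, norm_sub_sq_real, norm_smul, norm_coe,
    inner_smul_right, EuclideanSpace.inner_single_left]
  simp
  ring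

/-- Along `x + s e_i` the extension is `g (N^(-1/2) (Z + sδ))` with `N` quadratic in `s`. Two
differentiations at `s = 0`, summed over `i` with `∑ x_i² = 1`, give the formula. -/
lemma lapBeltrami_zonal {g g' g'' : ℝ → ℝ} (hg2 : ContDiff ℝ 2 g)
    (hg : ∀ z, HasDerivAt g (g' z) z) (hg' : ∀ z, HasDerivAt g' (g'' z) z) (x : S d) :
    lapBeltrami (fun y => g (coord 0 y)) x =
      (1 - coord 0 x ^ 2) * g'' (coord 0 x) - d * coord 0 x * g' (coord 0 x) := by
  have hC := contDiffAt_radialExt (contMDiff_zonal (d := d) hg2) x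
  have hline : ∀ i : Fin (d + 1),
      iteratedFDeriv ℝ 2 (radialExt (fun y : S d => g (coord 0 y)))
        (x : EuclideanSpace ℝ (Fin (d + 1)))
        ![EuclideanSpace.basisFun (Fin (d + 1)) ℝ i, EuclideanSpace.basisFun (Fin (d + 1)) ℝ i] =
      g'' (coord 0 x) * ((if i = 0 then 1 else 0) - coord 0 x * coord i x) ^ 2 +
        g' (coord 0 x) * (-2 * (if i = 0 then 1 else 0) * coord i x - coord 0 x +
          3 * coord 0 x * coord i x ^ 2) := by
    intro i
    set e := EuclideanSpace.basisFun (Fin (d + 1)) ℝ i with he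
    set δ : ℝ := if i = 0 then 1 else 0 with hδ
    set X := coord i x
    set Z := coord 0 x
    set N : ℝ → ℝ := fun s => 1 + 2 * s * X + s ^ 2 with hN
    have hnorm : ∀ s : ℝ, ‖(x : EuclideanSpace ℝ (Fin (d + 1))) + s • e‖ ^ 2 = N s := by
      intro s
      rw [norm_add_sq_real, norm_coe, inner_smul_right, norm_smul, he,
        OrthonormalBasis.norm_eq_one, real_inner_comm]
      simp [EuclideanSpace.inner_single_left, hN, X, coord]
      ring
    have hcoord : ∀ s : ℝ, ((x : EuclideanSpace ℝ (Fin (d + 1))) + s • e) 0 = Z + s * δ := by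
      intro s
      simp [he, hδ, Z, coord, eq_comm]
    have hNd : ∀ s, HasDerivAt N (2 * X + 2 * s) s := by
      intro s
      have := (((hasDerivAt_id s).const_mul 2).mul_const X |>.const_add 1).add
        ((hasDerivAt_id s).pow 2)
      refine this.congr_deriv ?_
      simp
    have hN0 : N 0 = 1 := by simp [hN]
    have hNpos : ∀ᶠ s in 𝓝 (0 : ℝ), 0 < N s :=
      (hNd 0).continuousAt.eventually (lt_mem_nhds (by rw [hN0]; exact one_pos))
    have hZd : ∀ s, HasDerivAt (fun s => Z + s * δ) δ s := fun s => by
      simpa using ((hasDerivAt_id s).mul_const δ).const_add Z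
    set φ : ℝ → ℝ := fun s => N s ^ (-(1 / 2) : ℝ) * (Z + s * δ) with hφ
    set φ' : ℝ → ℝ := fun s => (2 * X + 2 * s) * (-(1 / 2)) * N s ^ (-(1 / 2) - 1 : ℝ) *
      (Z + s * δ) + N s ^ (-(1 / 2) : ℝ) * δ with hφ'
    have hφd : ∀ s, 0 < N s → HasDerivAt φ (φ' s) s := fun s hs =>
      ((hNd s).rpow_const (Or.inl hs.ne')).mul (hZd s)
    have hφ0 : φ 0 = Z := by simp [hφ, hN0]
    have hφ'd : HasDerivAt φ' (-2 * δ * X - Z + 3 * Z * X ^ 2) 0 := by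
      have h1 : HasDerivAt (fun s : ℝ => (2 * X + 2 * s) * (-(1 / 2))) (2 * 1 * (-(1 / 2))) 0 :=
        (((hasDerivAt_id (0 : ℝ)).const_mul 2).const_add _).mul_const _
      have hne : N 0 ≠ 0 := by rw [hN0]; exact one_ne_zero
      have h2 := (h1.mul ((hNd 0).rpow_const (p := -(1 / 2) - 1) (Or.inl hne))).mul (hZd 0)
      have h3 := ((hNd 0).rpow_const (p := -(1 / 2)) (Or.inl hne)).mul_const δ
      refine (h2.add h3).congr_deriv ?_
      simp [hN0]
      ring
    refine iteratedFDeriv_two_eq_of_hasDerivAt hC e (φ' := fun s => g' (φ s) * φ' s) ?_ ?_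
    · have hev : ∀ᶠ s in 𝓝 (0 : ℝ), ∀ᶠ r in 𝓝 s, 0 < N r := eventually_eventually_nhds.2 hNpos
      filter_upwards [hev] with s hs
      refine ((hg _).comp s (hφd s hs.self_of_nhds)).congr_of_eventuallyEq ?_
      filter_upwards [hs] with r hr
      rw [radialExt_zonal_eq g, hnorm, hcoord]
      · rfl
      · intro h0
        have := hnorm r
        rw [h0] at this
        simp at this
        exact hr.ne this
    · have h1 := ((hg' (φ 0)).comp 0 (hφd 0 (by rw [hN0]; exact one_pos))).mul hφ'd
      refine h1.congr_deriv ?_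
      have hφ'0 : φ' 0 = δ - Z * X := by simp [hφ', hN0]; ring
      simp only [Function.comp_apply, hφ0, hφ'0]
      ring
  rw [lapBeltrami, InnerProductSpace.laplacian_eq_iteratedFDeriv_orthonormalBasis _
    (EuclideanSpace.basisFun (Fin (d + 1)) ℝ)]
  simp only [hline]
  have hs := sum_coord_sq x
  have e1 : ∑ i : Fin (d + 1), ((if i = 0 then (1 : ℝ) else 0) - coord 0 x * coord i x) ^ 2
      = 1 - coord 0 x ^ 2 := by
    have : ∀ i : Fin (d + 1), ((if i = 0 then (1 : ℝ) else 0) - coord 0 x * coord i x) ^ 2 =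
        (if i = 0 then 1 - 2 * coord 0 x ^ 2 else 0) + coord 0 x ^ 2 * coord i x ^ 2 := by
      intro i
      split_ifs with h
      · subst h; ring
      · ring
    simp only [this, Finset.sum_add_distrib, ← Finset.mul_sum, hs]
    simp
    ring
  have e2 : ∑ i : Fin (d + 1), (-2 * (if i = 0 then (1 : ℝ) else 0) * coord i x - coord 0 x +
      3 * coord 0 x * coord i x ^ 2) = -(d * coord 0 x) := by
    simp only [Finset.sum_add_distrib, Finset.sum_sub_distrib, ← Finset.mul_sum, hs]
    simp
    ring
  rw [Finset.sum_add_distrib, ← Finset.mul_sum, ← Finset.mul_sum, e1, e2]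
  ring

/-! ### The dissipation identity -/

/-- The quadratic form in `(u'', u' ^ 2 / u)` that governs the dissipation of a zonal profile. -/
def dissipation (d p u u₁ u₂ : ℝ) : ℝ :=
  u₂ ^ 2 + (p - 1) * d / (d + 2) * (u₁ ^ 4 / u ^ 2) -
    2 * (p - 1) * (d - 1) / (d + 2) * (u₂ * u₁ ^ 2 / u)

/-- The dissipation identity: `v` is the time derivative of `u` when `u ^ p` follows the heat flow,
and `v₁` is its derivative. -/
lemma integral_dissipation {p : ℝ} (hp : 2 < p) {u u₁ u₂ u₃ : ℝ → ℝ}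
    (h0 : ∀ z ∈ Icc (-1 : ℝ) 1, 0 < u z)
    (h1 : ∀ z ∈ Icc (-1 : ℝ) 1, HasDerivAt u (u₁ z) z)
    (h2 : ∀ z ∈ Icc (-1 : ℝ) 1, HasDerivAt u₁ (u₂ z) z)
    (h3 : ∀ z ∈ Icc (-1 : ℝ) 1, HasDerivAt u₂ (u₃ z) z)
    (h4 : ContinuousOn u₃ (Icc (-1) 1)) {v v₁ : ℝ → ℝ}
    (hv : ∀ z, v z = (1 - z ^ 2) * u₂ z - d * z * u₁ z + (p - 1) * ((1 - z ^ 2) * (u₁ z ^ 2 / u z)))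
    (hv₁ : ∀ z, v₁ z = -2 * z * u₂ z + (1 - z ^ 2) * u₃ z - d * (u₁ z + z * u₂ z) +
      (p - 1) * (-2 * z * (u₁ z ^ 2 / u z) +
        (1 - z ^ 2) * (2 * u₁ z * u₂ z / u z - u₁ z ^ 3 / u z ^ 2))) :
    ∫ x : S d, ((1 - coord 0 x ^ 2) * (2 * u₁ (coord 0 x) * v₁ (coord 0 x)) +
        d / (p - 2) * (2 * u (coord 0 x) * v (coord 0 x))) ∂unif d =
      ∫ x : S d, -2 * (1 - coord 0 x ^ 2) ^ 2 *
        dissipation d p (u (coord 0 x)) (u₁ (coord 0 x)) (u₂ (coord 0 x)) ∂unif d := by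
  have c0 : ContinuousOn u (Icc (-1) 1) := fun z hz => (h1 z hz).continuousAt.continuousWithinAt
  have c1 : ContinuousOn u₁ (Icc (-1) 1) := fun z hz => (h2 z hz).continuousAt.continuousWithinAt
  have c2 : ContinuousOn u₂ (Icc (-1) 1) := fun z hz => (h3 z hz).continuousAt.continuousWithinAt
  have hne : ∀ z ∈ Icc (-1 : ℝ) 1, u z ≠ 0 := fun z hz => (h0 z hz).ne'
  have hne2 : ∀ z ∈ Icc (-1 : ℝ) 1, u z ^ 2 ≠ 0 := fun z hz => pow_ne_zero 2 (hne z hz)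
  have cv : ContinuousOn v (Icc (-1) 1) := by
    rw [show v = _ from funext hv]
    fun_prop (disch := assumption)
  have cv₁ : ContinuousOn v₁ (Icc (-1) 1) := by
    rw [show v₁ = _ from funext hv₁]
    fun_prop (disch := assumption)
  have dν : ∀ z : ℝ, HasDerivAt (fun z : ℝ => 1 - z ^ 2) (-(2 * z)) z := fun z => by
    simpa using (hasDerivAt_pow 2 z).const_sub 1
  have dv : ∀ z ∈ Icc (-1 : ℝ) 1, HasDerivAt v (v₁ z) z := by
    intro z hz
    rw [show v = _ from funext hv]
    have a := (((dν z).mul (h3 z hz)).sub (((hasDerivAt_id z).const_mul (d : ℝ)).mul (h2 z hz))).add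
      (((dν z).mul (((h2 z hz).pow 2).div (h1 z hz) (hne z hz))).const_mul (p - 1))
    refine a.congr_deriv ?_
    rw [hv₁]
    have := hne z hz
    simp only [Pi.pow_apply, Pi.div_apply, id]
    field_simp
    ring
  -- The terms of `h` integrate by parts, in order: `∫ u Lu`, `∫ (1-z²) u' v'`, `∫ (Lu)²` and `∫
  -- z(1-z²) u'³/u`. The entropy term yields `2d ∫ (1-z²)u'²`, which cancels the first-order part of
  -- `-2 ∫ (Lu)²`. The last term brings in the denominator `d + 2`.
  set h : ℝ → ℝ := fun z => 2 * d / (p - 2) * (u z * u₁ z) + 2 * (u₁ z * v z) +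
    2 * d * (z * u₁ z ^ 2) - 2 * (p - 1) * d / (d + 2) * ((1 - z ^ 2) * (u₁ z ^ 3 / u z)) with hh
  set h' : ℝ → ℝ := fun z => 2 * d / (p - 2) * (u₁ z * u₁ z + u z * u₂ z) +
    2 * (u₂ z * v z + u₁ z * v₁ z) + 2 * d * (u₁ z ^ 2 + z * (2 * u₁ z * u₂ z)) -
    2 * (p - 1) * d / (d + 2) * (-(2 * z) * (u₁ z ^ 3 / u z) +
      (1 - z ^ 2) * (3 * u₁ z ^ 2 * u₂ z / u z - u₁ z ^ 4 / u z ^ 2)) with hh'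
  have dh : ∀ z ∈ Icc (-1 : ℝ) 1, HasDerivAt h (h' z) z := by
    intro z hz
    have a := (((((h1 z hz).mul (h2 z hz)).const_mul (2 * d / (p - 2))).add
      (((h2 z hz).mul (dv z hz)).const_mul 2)).add
      (((hasDerivAt_id z).mul ((h2 z hz).pow 2)).const_mul (2 * (d : ℝ)))).sub
      (((dν z).mul (((h2 z hz).pow 3).div (h1 z hz) (hne z hz))).const_mul
        (2 * (p - 1) * d / (d + 2)))
    refine a.congr_deriv ?_
    have := hne z hz
    simp only [hh', Pi.pow_apply, Pi.div_apply, id]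
    field_simp
    ring
  have ch' : ContinuousOn h' (Icc (-1) 1) := by
    simp only [hh']
    fun_prop (disch := assumption)
  have hI := integral_zonal_eq_zero (d := d) dh ch'
  have hint : ∀ {g : ℝ → ℝ}, ContinuousOn g (Icc (-1) 1) →
      Integrable (fun x : S d => g (coord 0 x)) (unif d) := fun hg =>
    integrable_unif (continuous_comp_coord hg 0)
  have i1 := hint (g := fun z => (1 - z ^ 2) * h' z - d * z * h z)
    (by
      have : ContinuousOn h (Icc (-1) 1) := fun z hz =>
        (dh z hz).continuousAt.continuousWithinAt
      fun_prop)
  have i2 := hint (g := fun z => -2 * (1 - z ^ 2) ^ 2 * dissipation d p (u z) (u₁ z) (u₂ z))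
    (by
      unfold dissipation
      fun_prop (disch := assumption))
  rw [← add_zero (∫ x : S d, -2 * (1 - coord 0 x ^ 2) ^ 2 * _ ∂unif d), ← hI, ← integral_add i2 i1]
  refine integral_congr_ae (ae_of_all _ fun x => ?_)
  have hn := hne _ (coord_mem 0 x)
  have hp2 : p - 2 ≠ 0 := by linarith
  have hd2 : (d : ℝ) + 2 ≠ 0 := by positivity
  simp only [hh, hh', dissipation]
  generalize coord 0 x = z at *
  rw [hv z]
  generalize v₁ z = w
  field_simp
  ring

/-! ### Explicit heat flow of quadratic profiles -/

/-- A solution of the heat equation that is a polynomial of degree two in `x₀`. -/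
def profile (d : ℕ) (a b k t z : ℝ) : ℝ :=
  -- `z` and `z² - 1/(d+1)` are zonal harmonics of degrees 1 and 2, with eigenvalues `d` and
  -- `2(d+1)` of `-Δ`.
  a + b * Real.exp (-(d * t)) * z + k * Real.exp (-(2 * (d + 1) * t)) * (z ^ 2 - 1 / (d + 1))

/-- The derivative of `profile` in `z`. -/
def profile₁ (d : ℕ) (b k t z : ℝ) : ℝ :=
  b * Real.exp (-(d * t)) + k * Real.exp (-(2 * (d + 1) * t)) * (2 * z)

/-- The second derivative of `profile` in `z`. -/
def profile₂ (d : ℕ) (k t : ℝ) : ℝ := k * Real.exp (-(2 * (d + 1) * t)) * 2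

lemma hasDerivAt_profile (a b k t z : ℝ) :
    HasDerivAt (profile d a b k t) (profile₁ d b k t z) z := by
  unfold profile profile₁
  have := (((hasDerivAt_id z).const_mul (b * Real.exp (-(d * t)))).const_add a).add
    (((hasDerivAt_pow 2 z).sub_const (1 / ((d : ℝ) + 1))).const_mul
      (k * Real.exp (-(2 * (d + 1) * t))))
  refine this.congr_deriv ?_
  simp

lemma hasDerivAt_profile₁ (b k t z : ℝ) :
    HasDerivAt (profile₁ d b k t) (profile₂ d k t) z := by
  unfold profile₁ profile₂
  have := (((hasDerivAt_id z).const_mul 2).const_mul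
    (k * Real.exp (-(2 * (d + 1) * t)))).const_add (b * Real.exp (-(d * t)))
  refine this.congr_deriv ?_
  simp

lemma hasDerivAt_exp_neg_mul (c t : ℝ) :
    HasDerivAt (fun t => Real.exp (-(c * t))) (-c * Real.exp (-(c * t))) t := by
  have := (((hasDerivAt_id t).const_mul c).neg).exp
  refine this.congr_deriv ?_
  simp
  ring

/-- The time derivative of `profile`. -/
def profileT (d : ℕ) (b k t z : ℝ) : ℝ :=
  -- Written as the zonal Laplacian, so that `hasDerivAt_profile_time` is the heat equation itself.
  (1 - z ^ 2) * profile₂ d k t - d * z * profile₁ d b k t z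

/-- The mixed derivative of `profile`. -/
def profile₁T (d : ℕ) (b k t z : ℝ) : ℝ :=
  -(2 * z) * profile₂ d k t - d * (profile₁ d b k t z + z * profile₂ d k t)

lemma hasDerivAt_profile_time (a b k t z : ℝ) :
    HasDerivAt (fun t => profile d a b k t z) (profileT d b k t z) t := by
  unfold profile profileT profile₁ profile₂
  have := ((((hasDerivAt_exp_neg_mul d t).const_mul b).mul_const z).const_add a).add
    (((hasDerivAt_exp_neg_mul (2 * (d + 1)) t).const_mul k).mul_const (z ^ 2 - 1 / ((d : ℝ) + 1)))
  refine this.congr_deriv ?_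
  have : (d : ℝ) + 1 ≠ 0 := by positivity
  field_simp
  ring

lemma hasDerivAt_profile₁_time (b k t z : ℝ) :
    HasDerivAt (fun t => profile₁ d b k t z) (profile₁T d b k t z) t := by
  unfold profile₁T profile₁ profile₂
  have := ((hasDerivAt_exp_neg_mul d t).const_mul b).add
    (((hasDerivAt_exp_neg_mul (2 * (d + 1)) t).const_mul k).mul_const (2 * z))
  refine this.congr_deriv ?_
  ring

lemma contDiff_profile (a b k t : ℝ) {n : ℕ∞ω} : ContDiff ℝ n (profile d a b k t) := by
  unfold profile; fun_prop

lemma continuous_profile (a b k : ℝ) :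
    Continuous fun q : ℝ × ℝ => profile d a b k q.1 q.2 := by
  unfold profile; fun_prop

lemma continuous_profile₁ (b k : ℝ) :
    Continuous fun q : ℝ × ℝ => profile₁ d b k q.1 q.2 := by
  unfold profile₁; fun_prop

lemma continuous_profileT (b k : ℝ) :
    Continuous fun q : ℝ × ℝ => profileT d b k q.1 q.2 := by
  unfold profileT profile₁ profile₂; fun_prop

lemma continuous_profile₁T (b k : ℝ) :
    Continuous fun q : ℝ × ℝ => profile₁T d b k q.1 q.2 := by
  unfold profile₁T profile₁ profile₂; fun_prop

lemma isHeatSolution_profile (a b k : ℝ) :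
    IsHeatSolution (fun x : S d => profile d a b k 0 (coord 0 x))
      (fun t x => profile d a b k t (coord 0 x)) where
  initial := rfl
  continuousOn := ((continuous_profile a b k).comp
    (continuous_fst.prodMk ((continuous_coord 0).comp continuous_snd))).continuousOn
  contMDiff t _ := contMDiff_zonal (contDiff_profile a b k t)
  heat t _ x := by
    rw [lapBeltrami_zonal (contDiff_profile a b k t) (hasDerivAt_profile a b k t)
      (hasDerivAt_profile₁ b k t)]
    exact hasDerivAt_profile_time a b k t _

/-- Conservation of mass: the time derivative is a zonal Laplacian, which integrates to zero. -/
lemma integral_profile (a b k t : ℝ) :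
    ∫ x : S d, profile d a b k t (coord 0 x) ∂unif d =
      ∫ x : S d, profile d a b k 0 (coord 0 x) ∂unif d := by
  have h : ∀ t, HasDerivAt (fun t => ∫ x : S d, profile d a b k t (coord 0 x) ∂unif d) 0 t := by
    intro t
    have hx := continuous_coord (d := d) 0
    have := hasDerivAt_integral_of_continuousOn (unif d) (a := t) (τ := 1) one_pos
      (F := fun t x => profile d a b k t (coord 0 x))
      (F' := fun t x => profileT d b k t (coord 0 x))
      (fun t _ => (contDiff_profile (n := 0) a b k t).continuous.comp hx)
      ((continuous_profileT b k).comp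
        (continuous_fst.prodMk (hx.comp continuous_snd))).continuousOn
      (fun t _ x => hasDerivAt_profile_time a b k t _)
    refine this.congr_deriv ?_
    exact integral_zonal_eq_zero (fun z _ => hasDerivAt_profile₁ b k t z)
      continuousOn_const
  exact is_const_of_deriv_eq_zero (fun t => (h t).differentiableAt) (fun t => (h t).deriv) t 0

/-! ### The root `ρ^(1/p)` and the derivative of the functional -/

/-- Dividing by `f` instead of shifting the exponent keeps `f^(1/p)` as the only irrational
quantity; later identities become rational. -/
lemma hasDerivAt_rpow_inv {f : ℝ → ℝ} {f' z : ℝ} (p : ℝ) (hf : HasDerivAt f f' z) (h0 : 0 < f z) :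
    HasDerivAt (fun z => f z ^ (1 / p)) (1 / p * (f z ^ (1 / p) * f' / f z)) z := by
  refine (hf.rpow_const (p := 1 / p) (Or.inl h0.ne')).congr_deriv ?_
  rw [Real.rpow_sub_one h0.ne']
  ring

/-- The derivative of `(profile ^ (1 / p))` in `z`. -/
def root₁ (d : ℕ) (p a b k t z : ℝ) : ℝ :=
  1 / p * (profile d a b k t z ^ (1 / p) * profile₁ d b k t z / profile d a b k t z)

/-- The second derivative of `(profile ^ (1 / p))` in `z`. -/
def root₂ (d : ℕ) (p a b k t z : ℝ) : ℝ :=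
  1 / p * profile d a b k t z ^ (1 / p) * (profile₂ d k t / profile d a b k t z +
    (1 / p - 1) * (profile₁ d b k t z / profile d a b k t z) ^ 2)

lemma hasDerivAt_root {a b k t z : ℝ} (p : ℝ) (h0 : 0 < profile d a b k t z) :
    HasDerivAt (fun z => profile d a b k t z ^ (1 / p)) (root₁ d p a b k t z) z :=
  hasDerivAt_rpow_inv p (hasDerivAt_profile a b k t z) h0

lemma hasDerivAt_root₁ {a b k t z : ℝ} (p : ℝ) (h0 : 0 < profile d a b k t z) :
    HasDerivAt (root₁ d p a b k t) (root₂ d p a b k t z) z := by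
  have := (((hasDerivAt_root p h0).mul (hasDerivAt_profile₁ (d := d) b k t z)).div
    (hasDerivAt_profile a b k t z) h0.ne').const_mul (1 / p)
  refine this.congr_deriv ?_
  simp only [root₁, root₂, Pi.mul_apply]
  have := h0.ne'
  field_simp
  ring

/-- The third derivative of `(profile ^ (1 / p))` in `z`. -/
def root₃ (d : ℕ) (p a b k t z : ℝ) : ℝ :=
  1 / p * root₁ d p a b k t z * (profile₂ d k t / profile d a b k t z +
    (1 / p - 1) * (profile₁ d b k t z / profile d a b k t z) ^ 2) +
  1 / p * profile d a b k t z ^ (1 / p) *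
    (-(profile₂ d k t * profile₁ d b k t z) / profile d a b k t z ^ 2 +
    (1 / p - 1) * (2 * (profile₁ d b k t z / profile d a b k t z) *
      ((profile₂ d k t * profile d a b k t z - profile₁ d b k t z * profile₁ d b k t z) /
        profile d a b k t z ^ 2)))

lemma hasDerivAt_root₂ {a b k t z : ℝ} (p : ℝ) (h0 : 0 < profile d a b k t z) :
    HasDerivAt (root₂ d p a b k t) (root₃ d p a b k t z) z := by
  have hP := hasDerivAt_profile (d := d) a b k t z
  have := ((hasDerivAt_root p h0).const_mul (1 / p)).mul
    (((hasDerivAt_const z (profile₂ d k t)).div hP h0.ne').add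
      ((((hasDerivAt_profile₁ (d := d) b k t z).div hP h0.ne').pow 2).const_mul (1 / p - 1)))
  refine this.congr_deriv ?_
  simp only [root₁, root₃, Pi.add_apply, Pi.div_apply, Pi.pow_apply]
  have := h0.ne'
  simp

lemma fisher_profile {a b k t : ℝ} (p : ℝ) (h0 : ∀ z ∈ Icc (-1 : ℝ) 1, 0 < profile d a b k t z) :
    fisher p (fun x : S d => profile d a b k t (coord 0 x)) =
      ∫ x : S d, (1 - coord 0 x ^ 2) * root₁ d p a b k t (coord 0 x) ^ 2 ∂unif d := by
  refine integral_congr_ae (ae_of_all _ fun x => ?_)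
  exact norm_grad_zonal_sq (g := fun z => profile d a b k t z ^ (1 / p)) x
    (hasDerivAt_root p (h0 _ (coord_mem 0 x)))

/-- Mass conservation freezes the first term of the entropy, so only `∫ u²` evolves. -/
lemma entropy_profile {a b k t : ℝ} (p : ℝ) (h0 : ∀ z ∈ Icc (-1 : ℝ) 1, 0 < profile d a b k t z) :
    entropy p (fun x : S d => profile d a b k t (coord 0 x)) =
      1 / (p - 2) * ((∫ x : S d, profile d a b k 0 (coord 0 x) ∂unif d) ^ (2 / p) -
        ∫ x : S d, (profile d a b k t (coord 0 x) ^ (1 / p)) ^ 2 ∂unif d) := by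
  rw [entropy, integral_profile]
  congr 2
  refine integral_congr_ae (ae_of_all _ fun x => ?_)
  have := (h0 _ (coord_mem 0 x)).le
  simp only
  rw [← Real.rpow_natCast (_ ^ (1 / p)), ← Real.rpow_mul this]
  congr 1
  push_cast
  ring

lemma exists_profile_pos {a b k : ℝ} (h0 : ∀ z ∈ Icc (-1 : ℝ) 1, 0 < profile d a b k 0 z) :
    ∃ τ > 0, ∀ t ∈ Icc (0 - τ) (0 + τ), ∀ z ∈ Icc (-1 : ℝ) 1, 0 < profile d a b k t z := by
  have hev : ∀ᶠ t in 𝓝 (0 : ℝ), ∀ z ∈ Icc (-1 : ℝ) 1, 0 < profile d a b k t z := by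
    apply isCompact_Icc.eventually_forall_of_forall_eventually
    intro z hz
    exact (continuous_profile a b k).continuousAt.eventually (lt_mem_nhds (h0 z hz))
  obtain ⟨τ, hτ, h⟩ := Metric.eventually_nhds_iff_ball.1 hev
  refine ⟨τ / 2, by positivity, fun t ht => h t ?_⟩
  rw [mem_ball_zero_iff, Real.norm_eq_abs, abs_lt]
  constructor <;> linarith [ht.1, ht.2]

/-- The derivative of `I_p - d E_p` along the heat flow of a positive polynomial profile. -/
lemma hasDerivAt_fisher_sub_entropy {p a b k : ℝ} (hp : 2 < p)
    (h0 : ∀ z ∈ Icc (-1 : ℝ) 1, 0 < profile d a b k 0 z) :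
    HasDerivAt (fun t => fisher p (fun x : S d => profile d a b k t (coord 0 x)) -
        d * entropy p (fun x : S d => profile d a b k t (coord 0 x)))
      (∫ x : S d, -2 * (1 - coord 0 x ^ 2) ^ 2 * dissipation d p
        (profile d a b k 0 (coord 0 x) ^ (1 / p)) (root₁ d p a b k 0 (coord 0 x))
        (root₂ d p a b k 0 (coord 0 x)) ∂unif d) 0 := by
  obtain ⟨τ, hτ, hpos⟩ := exists_profile_pos h0
  have h00 : (0 : ℝ) ∈ Icc (0 - τ) (0 + τ) := by constructor <;> linarith
  set W : ℝ → ℝ → ℝ := fun t z => profile d a b k t z ^ (1 / p)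
  set WT : ℝ → ℝ → ℝ := fun t z => 1 / p * (W t z * profileT d b k t z / profile d a b k t z)
  set VT : ℝ → ℝ → ℝ := fun t z => 1 / p * (((WT t z * profile₁ d b k t z +
    W t z * profile₁T d b k t z) * profile d a b k t z -
    W t z * profile₁ d b k t z * profileT d b k t z) / profile d a b k t z ^ 2)
  have dW : ∀ t z, 0 < profile d a b k t z → HasDerivAt (fun t => W t z) (WT t z) t :=
    fun t z h => hasDerivAt_rpow_inv p (hasDerivAt_profile_time a b k t z) h
  have dV : ∀ t z, 0 < profile d a b k t z →
      HasDerivAt (fun t => root₁ d p a b k t z) (VT t z) t := fun t z h =>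
    (((dW t z h).mul (hasDerivAt_profile₁_time b k t z)).div
      (hasDerivAt_profile_time a b k t z) h.ne').const_mul (1 / p)
  have hmem : ∀ q ∈ (Icc (0 - τ) (0 + τ) ×ˢ univ : Set (ℝ × S d)),
      0 < profile d a b k q.1 (coord 0 q.2) := fun q hq => hpos _ hq.1 _ (coord_mem 0 _)
  have hq : Continuous fun q : ℝ × S d => (q.1, coord 0 q.2) :=
    continuous_fst.prodMk ((continuous_coord 0).comp continuous_snd)
  have hz : ContinuousOn (fun q : ℝ × S d => coord 0 q.2) (Icc (0 - τ) (0 + τ) ×ˢ univ) :=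
    ((continuous_coord 0).comp continuous_snd).continuousOn
  have cP := ((continuous_profile (d := d) a b k).comp hq).continuousOn
    (s := Icc (0 - τ) (0 + τ) ×ˢ univ)
  have cP₁ := ((continuous_profile₁ (d := d) b k).comp hq).continuousOn
    (s := Icc (0 - τ) (0 + τ) ×ˢ univ)
  have cPT := ((continuous_profileT (d := d) b k).comp hq).continuousOn
    (s := Icc (0 - τ) (0 + τ) ×ˢ univ)
  have cP₁T := ((continuous_profile₁T (d := d) b k).comp hq).continuousOn
    (s := Icc (0 - τ) (0 + τ) ×ˢ univ)
  have cW : ContinuousOn (fun q : ℝ × S d => W q.1 (coord 0 q.2))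
      (Icc (0 - τ) (0 + τ) ×ˢ univ) :=
    cP.rpow_const fun q hq => Or.inl (hmem q hq).ne'
  have cWT : ContinuousOn (fun q : ℝ × S d => WT q.1 (coord 0 q.2))
      (Icc (0 - τ) (0 + τ) ×ˢ univ) :=
    continuousOn_const.mul ((cW.mul cPT).div cP fun q hq => (hmem q hq).ne')
  have cV : ContinuousOn (fun q : ℝ × S d => root₁ d p a b k q.1 (coord 0 q.2))
      (Icc (0 - τ) (0 + τ) ×ˢ univ) :=
    continuousOn_const.mul ((cW.mul cP₁).div cP fun q hq => (hmem q hq).ne')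
  have cVT : ContinuousOn (fun q : ℝ × S d => VT q.1 (coord 0 q.2))
      (Icc (0 - τ) (0 + τ) ×ˢ univ) :=
    continuousOn_const.mul (((((cWT.mul cP₁).add (cW.mul cP₁T)).mul cP).sub
      ((cW.mul cP₁).mul cPT)).div (cP.pow 2) fun q hq => pow_ne_zero 2 (hmem q hq).ne')
  have slice : ∀ {F : ℝ → S d → ℝ},
      ContinuousOn (fun q : ℝ × S d => F q.1 q.2) (Icc (0 - τ) (0 + τ) ×ˢ univ) →
      ∀ t ∈ Icc (0 - τ) (0 + τ), Continuous (F t) := fun {F} hF t ht =>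
    hF.comp_continuous (f := fun x => (t, x)) (by fun_prop) fun x => ⟨ht, mem_univ x⟩
  let F : ℝ → S d → ℝ := fun t x => (1 - coord 0 x ^ 2) * root₁ d p a b k t (coord 0 x) ^ 2
  let F' : ℝ → S d → ℝ := fun t x => (1 - coord 0 x ^ 2) *
    (2 * root₁ d p a b k t (coord 0 x) * VT t (coord 0 x))
  let G : ℝ → S d → ℝ := fun t x => W t (coord 0 x) ^ 2
  let G' : ℝ → S d → ℝ := fun t x => 2 * W t (coord 0 x) * WT t (coord 0 x)
  have cF : ContinuousOn (fun q : ℝ × S d => F q.1 q.2) (Icc (0 - τ) (0 + τ) ×ˢ univ) :=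
    (continuousOn_const.sub (hz.pow 2)).mul (cV.pow 2)
  have cF' : ContinuousOn (fun q : ℝ × S d => F' q.1 q.2) (Icc (0 - τ) (0 + τ) ×ˢ univ) :=
    (continuousOn_const.sub (hz.pow 2)).mul ((continuousOn_const.mul cV).mul cVT)
  have cG : ContinuousOn (fun q : ℝ × S d => G q.1 q.2) (Icc (0 - τ) (0 + τ) ×ˢ univ) := cW.pow 2
  have cG' : ContinuousOn (fun q : ℝ × S d => G' q.1 q.2) (Icc (0 - τ) (0 + τ) ×ˢ univ) :=
    (continuousOn_const.mul cW).mul cWT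
  have dF := hasDerivAt_integral_of_continuousOn (unif d) hτ
    (F := F) (F' := F') (slice cF) cF' (fun t ht x => by
    simpa [F, F'] using ((dV t _ (hpos t ht _ (coord_mem 0 x))).pow 2).const_mul (1 - coord 0 x ^ 2))
  have dG := hasDerivAt_integral_of_continuousOn (unif d) hτ
    (F := G) (F' := G') (slice cG) cG' (fun t ht x => by
    refine ((dW t _ (hpos t ht _ (coord_mem 0 x))).pow 2).congr_deriv ?_
    simp [G'])
  have dE := ((dG.const_sub ((∫ x : S d, profile d a b k 0 (coord 0 x) ∂unif d) ^ (2 / p))).const_mul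
    (1 / (p - 2))).const_mul (d : ℝ)
  refine ((dF.sub dE).congr_of_eventuallyEq ?_).congr_deriv ?_
  · filter_upwards [Icc_mem_nhds (by linarith : 0 - τ < 0) (by linarith : 0 < 0 + τ)] with t ht
    rw [fisher_profile p (hpos t ht), entropy_profile p (hpos t ht)]
    rfl
  · have hp0 : p ≠ 0 := by linarith
    have hP0 : ContinuousOn (profile d a b k 0) (Icc (-1) 1) :=
      (contDiff_profile (n := 0) a b k 0).continuous.continuousOn
    have hW0 : ContinuousOn (fun z => profile d a b k 0 z ^ (1 / p)) (Icc (-1) 1) :=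
      hP0.rpow_const fun z hz => Or.inl (h0 z hz).ne'
    have hP₁0 : ContinuousOn (profile₁ d b k 0) (Icc (-1) 1) := fun z _ =>
      (hasDerivAt_profile₁ b k 0 z).continuousAt.continuousWithinAt
    have hne : ∀ z ∈ Icc (-1 : ℝ) 1, profile d a b k 0 z ≠ 0 := fun z hz => (h0 z hz).ne'
    have hne2 : ∀ z ∈ Icc (-1 : ℝ) 1, profile d a b k 0 z ^ 2 ≠ 0 := fun z hz =>
      pow_ne_zero 2 (hne z hz)
    have hR₁ : ContinuousOn (root₁ d p a b k 0) (Icc (-1) 1) := fun z hz =>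
      (hasDerivAt_root₁ p (h0 z hz)).continuousAt.continuousWithinAt
    -- Here `v` is given by its spatial formula; its agreement with the time derivatives `WT` and
    -- `VT` is a pointwise rational identity in `w`, `r`, `r₁`, `r₂`, checked at the end.
    have key := integral_dissipation (d := d) hp (u := fun z => profile d a b k 0 z ^ (1 / p))
      (fun z hz => Real.rpow_pos_of_pos (h0 z hz) _)
      (fun z hz => hasDerivAt_root p (h0 z hz))
      (fun z hz => hasDerivAt_root₁ p (h0 z hz))
      (fun z hz => hasDerivAt_root₂ p (h0 z hz))
      (by
        unfold root₃
        fun_prop (disch := assumption))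
      (fun z => rfl) (fun z => rfl)
    rw [← key]
    have i1 := integrable_unif (slice (F := F') cF' 0 h00)
    have i2 := integrable_unif (slice (F := G') cG' 0 h00)
    rw [mul_neg, mul_neg, sub_neg_eq_add, ← integral_const_mul, ← integral_const_mul,
      ← integral_add i1 ((i2.const_mul _).const_mul _)]
    refine integral_congr_ae (ae_of_all _ fun x => ?_)
    have hr := h0 _ (coord_mem 0 x)
    have hw : profile d a b k 0 (coord 0 x) ^ (1 / p) ≠ 0 := (Real.rpow_pos_of_pos hr _).ne'
    have hr' := hr.ne'
    have hp2 : p - 2 ≠ 0 := by linarith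
    simp only [F', G', VT, WT, W, root₁, root₂, root₃, profileT, profile₁T]
    generalize coord 0 x = z at *
    generalize profile d a b k 0 z ^ (1 / p) = w at *
    generalize profile d a b k 0 z = r at *
    generalize profile₁ d b k 0 z = r₁ at *
    generalize profile₂ d k 0 = r₂ at *
    field_simp
    ring

/-! ### Choice of the profile and the exponents -/

lemma exists_profile_dissipation_neg {p : ℝ} (hp : 2 < p)
    (hd : (d : ℝ) * (d + 2) < (p - 1) * (d - 1) ^ 2) :
    ∃ a b k : ℝ, ∀ z ∈ Icc (-1 : ℝ) 1, 0 < profile d a b k 0 z ∧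
      dissipation d p (profile d a b k 0 z ^ (1 / p)) (root₁ d p a b k 0 z)
        (root₂ d p a b k 0 z) < 0 := by
  set c : ℝ := (p - 1) * (d - 1) / (d + 2) with hc
  set δ : ℝ := c ^ 2 - (p - 1) * d / (d + 2) with hδ
  have hd2 : (0 : ℝ) < d + 2 := by positivity
  have hδ0 : 0 < δ := by
    have : δ = (p - 1) / (d + 2) ^ 2 * ((p - 1) * (d - 1) ^ 2 - d * (d + 2)) := by
      rw [hδ, hc]; field_simp
    rw [this]
    exact mul_pos (div_pos (by linarith) (by positivity)) (by linarith)
  -- To leading order `u' = ε/p` and `u'' = ε²(2q/p + (1/p)(1/p - 1))`; this `q` solves `u'' = c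
  -- u'²` at order `ε²`.
  set κ : ℝ := 1 / p * (1 / p - 1) - c / p ^ 2 with hκ
  set q : ℝ := -κ * p / 2 with hq
  set r : ℝ → ℝ → ℝ := fun ε z => 1 + ε * z + q * ε ^ 2 * z ^ 2
  set m : ℝ → ℝ → ℝ := fun ε z => 1 + 2 * q * ε * z
  -- At `ε = 0` both `r` and `m` equal 1, leaving `-δ/p⁴ < 0`; compactness of `[-1,1]` makes the
  -- sign uniform in `z` for small `ε`.
  have hev : ∀ᶠ ε in 𝓝 (0 : ℝ), ∀ z ∈ Icc (-1 : ℝ) 1,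
      0 < r ε z ∧ κ ^ 2 * (m ε z ^ 2 - r ε z) ^ 2 - δ * m ε z ^ 4 / p ^ 4 < 0 := by
    apply isCompact_Icc.eventually_forall_of_forall_eventually
    intro z _
    have c1 : Continuous fun e : ℝ × ℝ => r e.1 e.2 := by fun_prop
    have c2 : Continuous fun e : ℝ × ℝ =>
        κ ^ 2 * (m e.1 e.2 ^ 2 - r e.1 e.2) ^ 2 - δ * m e.1 e.2 ^ 4 / p ^ 4 := by fun_prop
    refine (c1.continuousAt.eventually (lt_mem_nhds ?_)).and
      (c2.continuousAt.eventually (gt_mem_nhds ?_))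
    · simp [r]
    · simp only [m, r]
      have : 0 < δ / p ^ 4 := by positivity
      norm_num
      exact this
  obtain ⟨ε, h, hε⟩ := ((hev.filter_mono nhdsWithin_le_nhds).and self_mem_nhdsWithin :
    ∀ᶠ ε in 𝓝[>] (0 : ℝ), _ ∧ ε ∈ Ioi 0).exists
  rw [mem_Ioi] at hε
  -- The extra constant undoes the `1/(d+1)` subtracted in the degree-two harmonic.
  refine ⟨1 + q * ε ^ 2 / (d + 1), ε, q * ε ^ 2, fun z hz => ?_⟩
  obtain ⟨h1, h2⟩ := h z hz
  have e0 : profile d (1 + q * ε ^ 2 / (d + 1)) ε (q * ε ^ 2) 0 z = r ε z := by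
    simp [profile, r]; ring
  have e1 : profile₁ d ε (q * ε ^ 2) 0 z = ε * m ε z := by
    simp [profile₁, m]; ring
  have e2 : profile₂ d (q * ε ^ 2) 0 = -κ * p * ε ^ 2 := by
    simp [profile₂, hq]; ring
  refine ⟨by rw [e0]; exact h1, ?_⟩
  rw [root₁, root₂, e0, e1, e2]
  have hw : 0 < r ε z ^ (1 / p) := Real.rpow_pos_of_pos h1 _
  generalize r ε z ^ (1 / p) = w at *
  generalize r ε z = s at *
  generalize m ε z = y at *
  have hp0 : p ≠ 0 := by linarith
  have : dissipation d p w (1 / p * (w * (ε * y) / s))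
      (1 / p * w * (-κ * p * ε ^ 2 / s + (1 / p - 1) * (ε * y / s) ^ 2)) =
      w ^ 2 * ε ^ 4 / s ^ 4 * (κ ^ 2 * (y ^ 2 - s) ^ 2 - δ * y ^ 4 / p ^ 4) := by
    rw [dissipation, hδ, hκ, hc]
    field_simp
    ring
  rw [this]
  exact mul_neg_of_pos_of_neg (by positivity) h2

/-- Subtracting `(d-1)²` from `2d² + 1` leaves `d(d+2)`, so the second inequality is `p > 2^#`
rearranged. For `d = 1` the assumption is void, as `2^# = ⊤`. -/
lemma two_lt_and_lt_of_twoSharp_lt {p : ℝ} (hd : 1 ≤ d) (h : twoSharp d < (p : EReal)) :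
    2 < p ∧ (d : ℝ) * (d + 2) < (p - 1) * (d - 1) ^ 2 := by
  have hd1 : d ≠ 1 := by
    rintro rfl
    simp [twoSharp] at h
  have hd2 : (2 : ℝ) ≤ d := by exact_mod_cast (by omega : 2 ≤ d)
  rw [twoSharp, if_neg hd1, EReal.coe_lt_coe_iff] at h
  have hpos : (0 : ℝ) < (d - 1) ^ 2 := pow_pos (by linarith) 2
  rw [div_lt_iff₀ hpos] at h
  constructor
  · by_contra! hle
    nlinarith
  · nlinarith

/-- After cross-multiplication the cubics differ by `d + 2`. This places the endpoint `p = 2^*`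
above `2^#`. -/
lemma twoSharp_lt_twoStar (hd : 3 ≤ d) : twoSharp d < twoStar d := by
  rw [twoSharp, twoStar, if_neg (by omega), if_neg (by omega), EReal.coe_lt_coe_iff]
  have hd3 : (3 : ℝ) ≤ d := by exact_mod_cast hd
  rw [div_lt_div_iff₀ (pow_pos (by linarith) 2) (by linarith)]
  nlinarith

end SphereHeat

end

theorem proposition1 (d : ℕ) (hd : 1 ≤ d) (p : ℝ)
    (hp : (SphereHeat.twoSharp d < (p : EReal) ∧ (p : EReal) < SphereHeat.twoStar d) ∨
      (3 ≤ d ∧ (p : EReal) = SphereHeat.twoStar d)) :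
    ∃ ρ₀ : SphereHeat.S d → ℝ,
      ContMDiff (𝓡 d) 𝓘(ℝ, ℝ) ∞ ρ₀ ∧ (∀ x, 0 < ρ₀ x) ∧
      (∃ ρ : ℝ → SphereHeat.S d → ℝ, SphereHeat.IsHeatSolution ρ₀ ρ) ∧
      ∀ ρ : ℝ → SphereHeat.S d → ℝ, SphereHeat.IsHeatSolution ρ₀ ρ →
        ∃ D : ℝ, 0 < D ∧
          HasDerivWithinAt
            (fun t => SphereHeat.fisher p (ρ t) - (d : ℝ) * SphereHeat.entropy p (ρ t))
            D (Ici 0) 0 := by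
  have hsharp : SphereHeat.twoSharp d < (p : EReal) := by
    rcases hp with h | ⟨h3, h⟩
    · exact h.1
    · rw [h]; exact SphereHeat.twoSharp_lt_twoStar h3
  obtain ⟨hp2, hdp⟩ := SphereHeat.two_lt_and_lt_of_twoSharp_lt hd hsharp
  obtain ⟨a, b, k, hneg⟩ := SphereHeat.exists_profile_dissipation_neg hp2 hdp
  have hpos : ∀ z ∈ Icc (-1 : ℝ) 1, 0 < SphereHeat.profile d a b k 0 z := fun z hz => (hneg z hz).1
  -- By uniqueness any classical solution equals this flow for `t ≥ 0`, so its right derivative is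
  -- the two-sided one of the explicit flow.
  have hsol := SphereHeat.isHeatSolution_profile (d := d) a b k
  refine ⟨fun x => SphereHeat.profile d a b k 0 (SphereHeat.coord 0 x),
    SphereHeat.contMDiff_zonal (SphereHeat.contDiff_profile a b k 0),
    fun x => hpos _ (SphereHeat.coord_mem 0 x), ⟨_, hsol⟩, fun ρ hρ => ⟨_, ?_,
      (SphereHeat.hasDerivAt_fisher_sub_entropy hp2 hpos).hasDerivWithinAt.congr_of_mem
        (fun t ht => by rw [hρ.unique hsol ht]) self_mem_Ici⟩⟩
  · have hne : ∀ z ∈ Icc (-1 : ℝ) 1, SphereHeat.profile d a b k 0 z ^ (1 / p) ≠ 0 := fun z hz =>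
      (Real.rpow_pos_of_pos (hpos z hz) _).ne'
    have hne2 : ∀ z ∈ Icc (-1 : ℝ) 1, (SphereHeat.profile d a b k 0 z ^ (1 / p)) ^ 2 ≠ 0 :=
      fun z hz => pow_ne_zero 2 (hne z hz)
    have c0 : ContinuousOn (fun z => SphereHeat.profile d a b k 0 z ^ (1 / p)) (Icc (-1) 1) :=
      fun z hz => (SphereHeat.hasDerivAt_root p (hpos z hz)).continuousAt.continuousWithinAt
    have c1 : ContinuousOn (SphereHeat.root₁ d p a b k 0) (Icc (-1) 1) := fun z hz =>
      (SphereHeat.hasDerivAt_root₁ p (hpos z hz)).continuousAt.continuousWithinAt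
    have c2 : ContinuousOn (SphereHeat.root₂ d p a b k 0) (Icc (-1) 1) := fun z hz =>
      (SphereHeat.hasDerivAt_root₂ p (hpos z hz)).continuousAt.continuousWithinAt
    have hcont := SphereHeat.continuous_comp_coord (d := d)
      (g := fun z => -2 * (1 - z ^ 2) ^ 2 * SphereHeat.dissipation d p
        (SphereHeat.profile d a b k 0 z ^ (1 / p)) (SphereHeat.root₁ d p a b k 0 z)
        (SphereHeat.root₂ d p a b k 0 z))
      (by
        unfold SphereHeat.dissipation
        fun_prop (disch := assumption)) 0
    -- The weight `(1-z²)²` vanishes at the poles, so strict positivity is tested on the equator;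
    -- the last axis differs from axis 0 because `d ≥ 1`.
    let x₁ : SphereHeat.S d := ⟨EuclideanSpace.single (Fin.last d) 1, by simp⟩
    refine hcont.integral_pos_of_hasCompactSupport_nonneg_nonzero
      (HasCompactSupport.of_compactSpace _) (fun x => ?_) (x := x₁) ?_
    · have := (hneg _ (SphereHeat.coord_mem 0 x)).2
      have hsq := sq_nonneg (1 - SphereHeat.coord 0 x ^ 2)
      simp only [Pi.zero_apply]
      nlinarith
    · have h0 : SphereHeat.coord 0 x₁ = 0 := by
        have : Fin.last d ≠ 0 := by
          rw [Ne, Fin.last_eq_zero_iff]; omega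
        simp [x₁, SphereHeat.coord, this.symm]
      have := (hneg _ (SphereHeat.coord_mem 0 x₁)).2
      rw [h0] at this
      simp only [h0]
      intro hcon
      have h2 : -2 * (1 - (0 : ℝ) ^ 2) ^ 2 ≠ 0 := by norm_num
      exact this.ne ((mul_eq_zero.1 hcon).resolve_left h2)
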